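/- Let $G=(V,E)$ be a finite undirected graph with a finite set $E_b$ of bulk edges (each joining two vertices) and a finite non-empty set $E_\partial$ of boundary half-edges (each attached to one vertex), and suppose that $G$ is bulk connected: $V\neq\emptyset$ and any two vertices are joined by a path of bulk edges. Parallel edges, loops, and several half-edges at one vertex are allowed. For an integer $D\ge 1$, attach a copy of $\mathbb C^D$ to every half-edge and to each of the two ends of every bulk edge. For $x\in V$ let $\mathcal H_x$ be the tensor product of the copies of $\mathbb C^D$ at $x$, and let $g_x\in\mathcal H_x$ $(x\in V)$ be independent random vectors whose coordinates in the product basis are i.i.d. standard complex Gaussian variables (independent real and imaginary parts, centred, of variance $1/2$). For $e\in E_b$ let $\Omega_e=D^{-1/2}\sum_{i=1}^D |i\rangle\otimes|i\rangle\in\mathbb C^D\otimes\mathbb C^D$. Let $$|\psi_G\rangle=\Big\langle \bigotimes_{e\in E_b}\Omega_e\ \Big|\ \bigotimes_{x\in V}g_x\Big\rangle\in(\mathbb C^D)^{\otimes|E_\partial|}$$ and, for $A\subseteq E_\partial$, let $\rho_A=\operatorname{Tr}_B|\psi_G\rangle\langle\psi_G|$ be the partial trace over the half-edges in $B=E_\partial\setminus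 A$. Then, for every $A\subseteq E_\partial$ and every $n\in\mathbb N$, the random variable $\big(\operatorname{Tr}(D^{-|E_\partial|}\rho_A)\big)^n$ is integrable for every $D\ge1$, and $$\lim_{D\to\infty}\mathbb E\Big[\big(\operatorname{Tr}(D^{-|E_\partial|}\rho_A)\big)^n\Big]=1.$$ Moreover, for every $n\in\mathbb N$ the Hamiltonian for the empty boundary region, $$h_G^{(n)}(\alpha)=\sum_{(x,\cdot)\in E_\partial}|\mathrm{id}^{-1}\alpha_x|+\sum_{(x,y)\in E_b}|\alpha_x^{-1}\alpha_y|,\qquad \alpha=(\alpha_x)\in\mathcal S_n^{V},$$ where $|\sigma|=n-\#\sigma$ and $\#\sigma$ is the number of cycles of $\sigma\in\mathcal S_n$ (fixed points included), has minimum $0$, and $h_G^{(n)}(\alpha)=0$ if and only if $\alpha_x=\mathrm{id}$ for all $x\in V$. -/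

import Mathlib

open MeasureTheory ProbabilityTheory Filter Topology

/-- A graph with vertex set `V`, bulk (full) edges `Eb` and boundary (half) edges `Ed`.
A bulk edge `e` joins `src e` and `tgt e`; the choice of which endpoint is called `src` is a mere
labelling, the graph is undirected. A half-edge `e` is attached to the single vertex `foot e`.
Parallel edges, loops, and several half-edges at one vertex are allowed. -/
structure OpenGraph (V Eb Ed : Type*) where
  src : Eb → V
  tgt : Eb → V
  foot : Ed → V

namespace OpenGraph

variable {V Eb Ed : Type*}

/-- Bulk connectivity: any two vertices are joined by a path of bulk edges
(and there is at least one vertex). -/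
def BulkConnected (G : OpenGraph V Eb Ed) : Prop :=
  (SimpleGraph.fromRel (fun x y : V => ∃ e : Eb, G.src e = x ∧ G.tgt e = y)).Connected

/-- The vertex at which a leg sits. The legs are the two ends of every bulk edge and the
half-edges; each leg carries a copy of `ℂ^D`. -/
def legVertex (G : OpenGraph V Eb Ed) : Eb ⊕ Eb ⊕ Ed → V :=
  Sum.elim G.src (Sum.elim G.tgt G.foot)

/-- The legs incident to the vertex `x`. -/
abbrev LegsAt (G : OpenGraph V Eb Ed) (x : V) : Type _ :=
  {l : Eb ⊕ Eb ⊕ Ed // G.legVertex l = x}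

/-- A vector in the vertex Hilbert space `H_x`, the tensor product of one copy of `ℂ^D` for every
leg at `x`, given by its coordinates in the product basis. -/
abbrev VertexTensor (G : OpenGraph V Eb Ed) (D : ℕ) (x : V) : Type _ :=
  (G.LegsAt x → Fin D) → ℂ

end OpenGraph

/-- The law of a standard complex Gaussian variable `X + iY`: the real and imaginary parts are
independent, centred Gaussians of variance `1/2`, so that the mean of `|X + iY|²` is `1`. -/
noncomputable def stdComplexGaussian : Measure ℂ :=
  ((gaussianReal 0 (1 / 2)).prod (gaussianReal 0 (1 / 2))).map
    Complex.measurableEquivRealProd.symm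

namespace OpenGraph

variable {V Eb Ed : Type*} [Fintype V] [DecidableEq V] [Fintype Eb] [DecidableEq Eb]
  [Fintype Ed] [DecidableEq Ed]

/-- The joint law of the random vertex tensors `(g_x)`: all coordinates of all the `g_x`
are i.i.d. standard complex Gaussian variables. -/
noncomputable def tensorLaw (G : OpenGraph V Eb Ed) (D : ℕ) :
    Measure ((x : V) → G.VertexTensor D x) :=
  Measure.pi fun x => Measure.pi fun _ : G.LegsAt x → Fin D => stdComplexGaussian

end OpenGraph

/-- The coordinates of the maximally entangled state `D^(-1/2) ∑ i, |i, i⟩` in `ℂ^D ⊗ ℂ^D`. -/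
noncomputable def maxEntangled (D : ℕ) (i j : Fin D) : ℂ :=
  if i = j then ((Real.sqrt D)⁻¹ : ℝ) else 0

namespace OpenGraph

variable {V Eb Ed : Type*} [Fintype V] [DecidableEq V] [Fintype Eb] [DecidableEq Eb]
  [Fintype Ed] [DecidableEq Ed]

/-- The random tensor network state `⟨⨂_e Ω_e | ⨂_x g_x⟩`, a vector in the tensor product of one
copy of `ℂ^D` for every half-edge, given by its coordinates. The sum runs over the basis labels
`c e`, `c' e` of the two ends of all bulk edges `e`. -/
noncomputable def state (G : OpenGraph V Eb Ed) (D : ℕ) (g : (x : V) → G.VertexTensor D x)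
    (b : Ed → Fin D) : ℂ :=
  ∑ c : Eb → Fin D, ∑ c' : Eb → Fin D,
    (∏ e, star (maxEntangled D (c e) (c' e))) *
      ∏ x, g x fun l => Sum.elim c (Sum.elim c' b) l.1

/-- The basis label on all half-edges whose parts on `A` and on its complement are `a` and `b`. -/
def glue {D : ℕ} (A : Finset Ed) (a : {e // e ∈ A} → Fin D) (b : {e // e ∉ A} → Fin D) :
    Ed → Fin D :=
  fun e => if h : e ∈ A then a ⟨e, h⟩ else b ⟨e, h⟩

/-- The reduced matrix `ρ_A = Tr_B |ψ⟩⟨ψ|` of the tensor network state, where `B` is the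
complement of the boundary region `A`. -/
noncomputable def reduced (G : OpenGraph V Eb Ed) (D : ℕ) (A : Finset Ed)
    (g : (x : V) → G.VertexTensor D x) :
    Matrix ({e // e ∈ A} → Fin D) ({e // e ∈ A} → Fin D) ℂ :=
  Matrix.of fun a a' =>
    ∑ b : {e // e ∉ A} → Fin D, G.state D g (glue A a b) * star (G.state D g (glue A a' b))

end OpenGraph

/-- The Cayley length `n - #σ` of a permutation of `n` points, where `#σ` is its number of
cycles, fixed points included; the Cayley distance of `σ` and `τ` is the length of `σ⁻¹ τ`. -/
noncomputable def cayleyLength {n : ℕ} (σ : Equiv.Perm (Fin n)) : ℤ :=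
  (n : ℤ) - (Nat.card (Quotient (Equiv.Perm.SameCycle.setoid σ)) : ℤ)

/-- The Hamiltonian for the empty boundary region, on assignments of a permutation to every
vertex: every half-edge is attached to the identity permutation. -/
noncomputable def OpenGraph.hamiltonian {V Eb Ed : Type*} [Fintype Eb] [Fintype Ed]
    (G : OpenGraph V Eb Ed) (n : ℕ) (α : V → Equiv.Perm (Fin n)) : ℤ :=
  (∑ e : Ed, cayleyLength ((1 : Equiv.Perm (Fin n))⁻¹ * α (G.foot e))) +
    ∑ e : Eb, cayleyLength ((α (G.src e))⁻¹ * α (G.tgt e))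

/-! The trace of `ρ_A` is the squared norm of the state, so `A` plays no role. Its `n`-th power
expands into a finite sum of monomials in the `g_x` and their conjugates. Wick's formula at each
vertex turns the expectation of a monomial into a count of `α : V → Perm (Fin n)` matching
holomorphic with antiholomorphic labels (`integral_vertex_monomial`).

For fixed `α` the matching constraints decouple over edges: the labels on an edge form a function
constant on the cycles of `α_x` (half-edge) or of `α_x⁻¹ α_y` (bulk edge), giving one factor `D` per
cycle (`card_matched_labels`). The normalisation removes `D ^ n` per edge, so for `D > 0` the moment
is exactly the partition function `∑ α, D ^ (-H α)` (`integral_normalized_trace_pow`).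

The energy `H` is a sum of non-negative integers. Zero energy forces `α` to be constant along bulk
edges and trivial at half-edges, hence trivial by connectivity (`hamiltonian_eq_zero_iff`). This
unique ground state contributes `1`; all other terms tend to `0`. -/

/-! ### Moments of one standard complex Gaussian. -/

instance : IsProbabilityMeasure stdComplexGaussian :=
  Measure.isProbabilityMeasure_map Complex.measurableEquivRealProd.symm.measurable.aemeasurable

theorem integral_stdComplexGaussian {E : Type*} [NormedAddCommGroup E] [NormedSpace ℝ E]
    (f : ℂ → E) :
    ∫ z, f z ∂stdComplexGaussian = ∫ z : ℂ, (Real.pi⁻¹ * Real.exp (-‖z‖ ^ 2)) • f z := by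
  have hhalf : (1 / 2 : NNReal) ≠ 0 := by norm_num
  rw [stdComplexGaussian, integral_map_equiv, gaussianReal_of_var_ne_zero _ hhalf,
    prod_withDensity (measurable_gaussianPDF _ _) (measurable_gaussianPDF _ _),
    integral_withDensity_eq_integral_toReal_smul (by
      exact ((measurable_gaussianPDF _ _).comp measurable_fst).mul
        ((measurable_gaussianPDF _ _).comp measurable_snd))
      (ae_of_all _ fun _ => ENNReal.mul_lt_top gaussianPDF_lt_top gaussianPDF_lt_top)]
  rw [← Complex.volume_preserving_equiv_real_prod.symm.integral_comp
    Complex.measurableEquivRealProd.symm.measurableEmbedding]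
  refine integral_congr_ae (ae_of_all _ fun p => ?_)
  obtain ⟨x, y⟩ := p
  have h2 : ‖Complex.measurableEquivRealProd.symm (x, y)‖ ^ 2 = x ^ 2 + y ^ 2 := by
    rw [← Complex.normSq_eq_norm_sq]
    change x * x + y * y = _
    ring
  have h1 : ((√(2 * Real.pi * ((1 / 2 : NNReal) : ℝ)))⁻¹ : ℝ) = (√Real.pi)⁻¹ := by
    congr 2
    push_cast
    ring
  simp only [ENNReal.toReal_mul, toReal_gaussianPDF, gaussianPDFReal, h1, h2]
  congr 1
  have h3 : Real.pi⁻¹ = (√Real.pi)⁻¹ * (√Real.pi)⁻¹ := by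
    rw [← mul_inv, Real.mul_self_sqrt Real.pi_pos.le]
  rw [h3, neg_add, Real.exp_add]
  have h4 (t : ℝ) : -(t - 0) ^ 2 / (2 * ((1 / 2 : NNReal) : ℝ)) = -t ^ 2 := by
    push_cast
    ring
  rw [h4, h4]
  ring

theorem integral_norm_pow_stdComplexGaussian (m : ℕ) :
    ∫ z, ‖z‖ ^ m ∂stdComplexGaussian = Real.Gamma ((m + 2) / 2) := by
  rw [integral_stdComplexGaussian]
  have h := Complex.integral_rpow_mul_exp_neg_rpow (p := 2) (q := m) (by norm_num)
    (by have : (0 : ℝ) ≤ m := m.cast_nonneg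
        linarith)
  simp only [Real.rpow_natCast, Real.rpow_ofNat] at h
  simp only [smul_eq_mul, mul_assoc, integral_const_mul]
  simp only [mul_comm (Real.exp _)]
  rw [h]
  field_simp

theorem integrable_pow_mul_star_pow_stdComplexGaussian (a b : ℕ) :
    Integrable (fun z : ℂ => z ^ a * star z ^ b) stdComplexGaussian := by
  have h : Integrable (fun z : ℂ => ‖z‖ ^ (a + b)) stdComplexGaussian := by
    -- The Bochner integral of a non-integrable function is `0`, so a positive Gamma value proves
    -- integrability.
    refine .of_integral_ne_zero ?_
    rw [integral_norm_pow_stdComplexGaussian]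
    exact (Real.Gamma_pos_of_pos (by positivity)).ne'
  refine h.mono' (by fun_prop) (ae_of_all _ fun z => ?_)
  simp [pow_add]

/-- The density depends only on `‖z‖`, and rotations preserve Lebesgue measure. -/
theorem integral_mul_unit_stdComplexGaussian (f : ℂ → ℂ) (w : Circle) :
    ∫ z, f (w * z) ∂stdComplexGaussian = ∫ z, f z ∂stdComplexGaussian := by
  rw [integral_stdComplexGaussian, integral_stdComplexGaussian,
    ← (rotation w).measurePreserving.integral_comp (rotation w).toHomeomorph.measurableEmbedding
      fun z => (Real.pi⁻¹ * Real.exp (-‖z‖ ^ 2)) • f z]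
  refine integral_congr_ae (ae_of_all _ fun z => ?_)
  simp only [rotation_apply, norm_mul, Circle.norm_coe, one_mul]

theorem integral_pow_mul_star_pow_stdComplexGaussian (a b : ℕ) :
    ∫ z, z ^ a * star z ^ b ∂stdComplexGaussian = if a = b then (a.factorial : ℂ) else 0 := by
  split_ifs with hab
  · subst hab
    have h (z : ℂ) : z ^ a * star z ^ a = ((‖z‖ ^ (2 * a) : ℝ) : ℂ) := by
      rw [← mul_pow, Complex.star_def, Complex.mul_conj, Complex.normSq_eq_norm_sq, pow_mul]
      push_cast
      rfl
    simp only [h]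
    rw [integral_complex_ofReal, integral_norm_pow_stdComplexGaussian]
    have : ((2 * a : ℕ) + 2 : ℝ) / 2 = a + 1 := by
      push_cast
      ring
    rw [this, Real.Gamma_nat_eq_factorial]
    simp
  · set I := ∫ z, z ^ a * star z ^ b ∂stdComplexGaussian with hI
    have hd : ((a : ℝ) - b) ≠ 0 := sub_ne_zero.2 (by exact_mod_cast hab)
    -- Rotation by `w` multiplies the integrand by `w ^ (a - b)`; this angle makes the factor `-1`,
    -- so `I = -I`.
    set w : Circle := Circle.exp (Real.pi / (a - b)) with hw
    have hrot := integral_mul_unit_stdComplexGaussian (fun z => z ^ a * star z ^ b) w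
    have hc : (w : ℂ) ^ a * star (w : ℂ) ^ b = -1 := by
      rw [hw, Circle.coe_exp, Complex.star_def, ← Complex.exp_conj, ← Complex.exp_nat_mul,
        ← Complex.exp_nat_mul, ← Complex.exp_add, ← Complex.exp_pi_mul_I]
      congr 1
      have hd' : ((a : ℂ) - b) ≠ 0 := by exact_mod_cast hd
      simp
      field_simp
      ring
    have hfac (z : ℂ) : ((w : ℂ) * z) ^ a * star ((w : ℂ) * z) ^ b = -(z ^ a * star z ^ b) := by
      rw [star_mul', mul_pow, mul_pow]
      linear_combination (z ^ a * star z ^ b) * hc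
    simp only [hfac, integral_neg, ← hI] at hrot
    exact self_eq_neg.1 hrot.symm

/-! ### Matchings of index families and Wick's formula. -/

theorem exists_perm_comp_eq {α ι : Type*} [Fintype α] [DecidableEq ι] (i j : α → ι)
    (h : ∀ p, Fintype.card {a // i a = p} = Fintype.card {a // j a = p}) :
    ∃ σ : Equiv.Perm α, ∀ a, i a = j (σ a) := by
  let e (p : ι) : {a // i a = p} ≃ {a // j a = p} := Fintype.equivOfCardEq (h p)
  refine ⟨(Equiv.sigmaFiberEquiv i).symm.trans
    ((Equiv.sigmaCongrRight e).trans (Equiv.sigmaFiberEquiv j)), fun a => ?_⟩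
  exact ((e (i a)) ⟨a, rfl⟩).2.symm

/-- The matchings, if any exist, form a coset of the stabiliser of `j`, which permutes each fibre
freely. The right-hand side is the product of the one-variable moments, so this is the combinatorial
half of Wick's formula. -/
theorem sum_perm_matching {α ι : Type*} [Fintype α] [DecidableEq α] [Fintype ι] [DecidableEq ι]
    (i j : α → ι) :
    (∑ σ : Equiv.Perm α, if ∀ a, i a = j (σ a) then (1 : ℂ) else 0) =
      ∏ p, if Fintype.card {a // i a = p} = Fintype.card {a // j a = p} then
        ((Fintype.card {a // i a = p}).factorial : ℂ) else 0 := by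
  by_cases h : ∀ p, Fintype.card {a // i a = p} = Fintype.card {a // j a = p}
  · obtain ⟨σ, hσ⟩ := exists_perm_comp_eq i j h
    simp only [h, if_true]
    rw [← Nat.cast_prod, ← DomMulAct.stabilizer_card j, Finset.sum_boole, ← Fintype.card_subtype]
    congr 1
    refine Fintype.card_congr ((Equiv.mulRight σ⁻¹).subtypeEquiv fun τ => ?_)
    rw [funext_iff, ← σ⁻¹.forall_congr_right]
    simp [hσ, eq_comm]
  · obtain ⟨p, hp⟩ := not_forall.1 h
    rw [Finset.prod_eq_zero (Finset.mem_univ p) (if_neg hp)]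
    refine Finset.sum_eq_zero fun σ _ => if_neg fun hσ => hp ?_
    refine Fintype.card_congr (σ.subtypeEquiv fun a => ?_)
    rw [hσ]

theorem prod_comp_eq_prod_pow_card {α ι M : Type*} [CommMonoid M] [Fintype α] [Fintype ι]
    [DecidableEq ι] (i : α → ι) (f : ι → M) :
    ∏ a, f (i a) = ∏ p, f p ^ Fintype.card {a // i a = p} := by
  rw [← Finset.prod_fiberwise' Finset.univ i f]
  simp [Fintype.card_subtype]

theorem prod_mul_star_eq_prod_pow {α ι : Type*} [Fintype α] [Fintype ι] [DecidableEq ι]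
    (i j : α → ι) (z : ι → ℂ) :
    ∏ a, z (i a) * star (z (j a)) =
      ∏ p, z p ^ Fintype.card {a // i a = p} * star (z p) ^ Fintype.card {a // j a = p} := by
  rw [Finset.prod_mul_distrib, Finset.prod_mul_distrib, prod_comp_eq_prod_pow_card i z,
    prod_comp_eq_prod_pow_card j fun p => star (z p)]

theorem integrable_gaussian_monomial {α ι : Type*} [Fintype α] [Fintype ι] (i j : α → ι) :
    Integrable (fun z : ι → ℂ => ∏ a, z (i a) * star (z (j a)))
      (Measure.pi fun _ => stdComplexGaussian) := by
  classical
  simp only [prod_mul_star_eq_prod_pow]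
  exact Integrable.fintype_prod fun p => integrable_pow_mul_star_pow_stdComplexGaussian _ _

/-- Wick's formula for i.i.d. standard complex Gaussian variables. -/
theorem integral_gaussian_monomial {α ι : Type*} [Fintype α] [DecidableEq α] [Fintype ι]
    [DecidableEq ι] (i j : α → ι) :
    ∫ z : ι → ℂ, ∏ a, z (i a) * star (z (j a)) ∂(Measure.pi fun _ => stdComplexGaussian) =
      ∑ σ : Equiv.Perm α, if ∀ a, i a = j (σ a) then (1 : ℂ) else 0 := by
  simp only [prod_mul_star_eq_prod_pow]
  rw [integral_fintype_prod_eq_prod (fun p (z : ℂ) => z ^ Fintype.card {a // i a = p} *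
    star z ^ Fintype.card {a // j a = p}), sum_perm_matching]
  exact Finset.prod_congr rfl fun p _ => integral_pow_mul_star_pow_stdComplexGaussian _ _

/-! ### Cayley length and counting by cycles. -/

theorem cayleyLength_nonneg {n : ℕ} (σ : Equiv.Perm (Fin n)) : 0 ≤ cayleyLength σ := by
  have h := Nat.card_le_card_of_surjective
    (Quotient.mk (Equiv.Perm.SameCycle.setoid σ)) Quotient.mk_surjective
  rw [Nat.card_fin] at h
  rw [cayleyLength]
  omega

theorem cayleyLength_eq_zero_iff {n : ℕ} (σ : Equiv.Perm (Fin n)) :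
    cayleyLength σ = 0 ↔ σ = 1 := by
  have hsurj : Function.Surjective (Quotient.mk (Equiv.Perm.SameCycle.setoid σ)) :=
    Quotient.mk_surjective
  constructor
  · intro h
    have hcard : Nat.card (Fin n) = Nat.card (Quotient (Equiv.Perm.SameCycle.setoid σ)) := by
      rw [cayleyLength] at h
      rw [Nat.card_fin]
      omega
    have hinj := ((Nat.bijective_iff_surjective_and_card _).2 ⟨hsurj, hcard⟩).1
    ext k
    have : σ k = k := hinj (Quotient.sound (Equiv.Perm.SameCycle.symm ⟨1, by simp⟩))
    simp [this]
  · rintro rfl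
    have hinj : Function.Injective
        (Quotient.mk (Equiv.Perm.SameCycle.setoid (1 : Equiv.Perm (Fin n)))) := by
      intro a b hab
      obtain ⟨m, hm⟩ := Quotient.exact hab
      simpa using hm
    have := Nat.card_congr (Equiv.ofBijective _ ⟨hinj, hsurj⟩)
    rw [Nat.card_fin] at this
    rw [cayleyLength]
    omega

/-- Functions invariant under a permutation are functions on its set of cycles. -/
theorem card_invariant_functions {n D : ℕ} (σ : Equiv.Perm (Fin n)) :
    Fintype.card {f : Fin n → Fin D // ∀ k, f k = f (σ k)} =
      D ^ Nat.card (Quotient (Equiv.Perm.SameCycle.setoid σ)) := by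
  classical
  have hinv (f : Fin n → Fin D) (hf : ∀ k, f k = f (σ k)) (a b : Fin n)
      (hab : σ.SameCycle a b) : f a = f b := by
    have hz (m : ℤ) : f a = f ((σ ^ m) a) := by
      induction m with
      | zero => simp
      | succ m ih => rw [ih, hf, ← Equiv.Perm.mul_apply, ← zpow_one_add, add_comm]
      | pred m ih =>
        rw [ih, hf ((σ ^ (-(m : ℤ) - 1)) a), ← Equiv.Perm.mul_apply, ← zpow_one_add]
        congr 3
        ring
    obtain ⟨m, rfl⟩ := hab
    exact hz m
  let e : {f : Fin n → Fin D // ∀ k, f k = f (σ k)} ≃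
      (Quotient (Equiv.Perm.SameCycle.setoid σ) → Fin D) :=
    { toFun := fun f => Quotient.lift f.1 fun a b hab => hinv f.1 f.2 a b hab
      invFun := fun F => ⟨fun k => F (Quotient.mk _ k), fun k =>
        congrArg F (Quotient.sound (show σ.SameCycle k (σ k) from ⟨1, by simp⟩))⟩
      left_inv := fun f => rfl
      right_inv := fun F => by
        ext q
        induction q using Quotient.inductionOn
        rfl }
  rw [← Nat.card_eq_fintype_card, Nat.card_congr e, Nat.card_fun]
  simp

theorem card_invariant_functions_eq_zpow {n D : ℕ} (hD : 0 < D) (σ : Equiv.Perm (Fin n)) :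
    (Fintype.card {f : Fin n → Fin D // ∀ k, f k = f (σ k)} : ℂ) =
      (D : ℂ) ^ n * (D : ℂ) ^ (-cayleyLength σ) := by
  have hD' : (D : ℂ) ≠ 0 := by exact_mod_cast hD.ne'
  rw [card_invariant_functions, ← zpow_natCast (D : ℂ) n, ← zpow_add₀ hD', cayleyLength]
  push_cast
  rw [← zpow_natCast]
  congr 1
  ring

/-- Pairs of functions matched by two permutations are functions invariant under the quotient
of these permutations. -/
theorem card_matched_pairs {n D : ℕ} (σ τ : Equiv.Perm (Fin n)) :
    Fintype.card {p : (Fin n → Fin D) × (Fin n → Fin D) //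
      (∀ k, p.1 k = p.2 (σ k)) ∧ ∀ k, p.1 k = p.2 (τ k)} =
    Fintype.card {f : Fin n → Fin D // ∀ k, f k = f ((σ⁻¹ * τ) k)} := by
  refine Fintype.card_congr
    { toFun := fun p => ⟨p.1.1, fun k => ?_⟩
      invFun := fun f => ⟨(f.1, fun k => f.1 (σ⁻¹ k)), fun k => ?_, fun k => ?_⟩
      left_inv := fun p => ?_
      right_inv := fun f => rfl }
  · rw [p.2.2 k, p.2.1]
    simp
  · simp
  · exact f.2 k
  · ext k
    · rfl
    · simp [p.2.1]

/-! ### Ground states of the Hamiltonian. -/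

namespace OpenGraph

variable {V Eb Ed : Type*}

theorem hamiltonian_nonneg [Fintype Eb] [Fintype Ed] (G : OpenGraph V Eb Ed) (n : ℕ)
    (α : V → Equiv.Perm (Fin n)) : 0 ≤ G.hamiltonian n α :=
  add_nonneg (Finset.sum_nonneg fun _ _ => cayleyLength_nonneg _)
    (Finset.sum_nonneg fun _ _ => cayleyLength_nonneg _)

theorem hamiltonian_eq_zero_iff [Fintype Eb] [Fintype Ed] (G : OpenGraph V Eb Ed)
    (hG : G.BulkConnected) (hEd : Nonempty Ed) (n : ℕ) (α : V → Equiv.Perm (Fin n)) :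
    G.hamiltonian n α = 0 ↔ ∀ x, α x = 1 := by
  rw [hamiltonian, add_eq_zero_iff_of_nonneg
    (Finset.sum_nonneg fun _ _ => cayleyLength_nonneg _)
    (Finset.sum_nonneg fun _ _ => cayleyLength_nonneg _),
    Finset.sum_eq_zero_iff_of_nonneg fun _ _ => cayleyLength_nonneg _,
    Finset.sum_eq_zero_iff_of_nonneg fun _ _ => cayleyLength_nonneg _]
  simp only [Finset.mem_univ, true_imp_iff, cayleyLength_eq_zero_iff, inv_one, one_mul,
    inv_mul_eq_one]
  constructor
  · rintro ⟨hb, he⟩ x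
    have hstep (u v : V)
        (h : (SimpleGraph.fromRel (fun x y : V => ∃ e : Eb, G.src e = x ∧ G.tgt e = y)).Adj u v) :
        α u = α v := by
      rw [SimpleGraph.fromRel_adj] at h
      obtain ⟨-, ⟨e, rfl, rfl⟩ | ⟨e, rfl, rfl⟩⟩ := h
      · exact he e
      · exact (he e).symm
    have hwalk (u v : V)
        (w : (SimpleGraph.fromRel
          (fun x y : V => ∃ e : Eb, G.src e = x ∧ G.tgt e = y)).Walk u v) : α u = α v := by
      induction w with
      | nil => rfl
      | cons h _ ih => rw [hstep _ _ h, ih]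
    obtain ⟨e⟩ := hEd
    obtain ⟨w⟩ := hG.preconnected x (G.foot e)
    rw [hwalk _ _ w, hb]
  · intro h
    simp [h]

theorem isLeast_hamiltonian [Fintype Eb] [Fintype Ed] (G : OpenGraph V Eb Ed)
    (hG : G.BulkConnected) (hEd : Nonempty Ed) (n : ℕ) :
    IsLeast (Set.range (G.hamiltonian n)) 0 :=
  ⟨⟨fun _ => 1, (G.hamiltonian_eq_zero_iff hG hEd n _).2 fun _ => rfl⟩,
    Set.forall_mem_range.2 (G.hamiltonian_nonneg n)⟩

/-- The partition function of the Hamiltonian counts its ground states at low temperature. -/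
theorem tendsto_sum_zpow_neg_hamiltonian [Fintype V] [DecidableEq V] [Fintype Eb] [Fintype Ed]
    (G : OpenGraph V Eb Ed) (hG : G.BulkConnected) (hEd : Nonempty Ed) (n : ℕ) :
    Tendsto (fun D : ℕ => ∑ α : V → Equiv.Perm (Fin n), (D : ℂ) ^ (-G.hamiltonian n α))
      atTop (𝓝 1) := by
  have hone : (1 : ℂ) = ∑ α : V → Equiv.Perm (Fin n), if α = fun _ => 1 then (1 : ℂ) else 0 := by
    simp
  rw [hone]
  refine tendsto_finsetSum _ fun α _ => ?_
  split_ifs with h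
  · rw [(G.hamiltonian_eq_zero_iff hG hEd n α).2 fun x => congrFun h x]
    simp
  · have hpos : 0 < G.hamiltonian n α :=
      lt_of_le_of_ne (G.hamiltonian_nonneg n α) fun h0 =>
        h (funext ((G.hamiltonian_eq_zero_iff hG hEd n α).1 h0.symm))
    obtain ⟨m, hm⟩ := Int.eq_ofNat_of_zero_le hpos.le
    have hm0 : m ≠ 0 := by omega
    -- The energy is a positive integer `m`, so the term is the `m`-th power of this null sequence.
    have hinv : Tendsto (fun D : ℕ => ((D : ℂ))⁻¹) atTop (𝓝 0) :=
      tendsto_inv_atTop_nhds_zero_nat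
    simpa [hm, hm0] using hinv.pow m

end OpenGraph

/-! ### Expansion of the trace into monomials in the vertex tensors. -/

theorem prod_zpow_neg {ι K : Type*} [Field K] {a : K} (ha : a ≠ 0) (s : Finset ι) (f : ι → ℤ) :
    ∏ i ∈ s, a ^ (-f i) = a ^ (-∑ i ∈ s, f i) := by
  classical
  induction s using Finset.induction_on with
  | empty => simp
  | insert i s hi ih =>
    rw [Finset.prod_insert hi, Finset.sum_insert hi, ih, ← zpow_add₀ ha, neg_add]

namespace OpenGraph

variable {V Eb Ed : Type*}

/-- The basis label of the legs at the vertex `x`, when both ends of every bulk edge `e` carry the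
label `c e` and every half-edge `e` carries the label `b e`. -/
def vertexLabel (G : OpenGraph V Eb Ed) {D : ℕ} (c : Eb → Fin D) (b : Ed → Fin D) (x : V) :
    G.LegsAt x → Fin D :=
  fun l => Sum.elim c (Sum.elim c b) l.1

theorem prod_star_maxEntangled [Fintype Eb] {D : ℕ} (c c' : Eb → Fin D) :
    ∏ e, star (maxEntangled D (c e) (c' e)) =
      if c = c' then (((Real.sqrt D)⁻¹ : ℝ) : ℂ) ^ Fintype.card Eb else 0 := by
  split_ifs with h
  · subst h
    simp [maxEntangled]
  · obtain ⟨e, he⟩ := Function.ne_iff.1 h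
    exact Finset.prod_eq_zero (Finset.mem_univ e) (by simp [maxEntangled, he])

theorem state_eq [Fintype V] [Fintype Eb] [DecidableEq Eb] (G : OpenGraph V Eb Ed) (D : ℕ)
    (g : (x : V) → G.VertexTensor D x) (b : Ed → Fin D) :
    G.state D g b = (((Real.sqrt D)⁻¹ : ℝ) : ℂ) ^ Fintype.card Eb *
      ∑ c : Eb → Fin D, ∏ x, g x (G.vertexLabel c b x) := by
  simp only [state, prod_star_maxEntangled, ite_mul, zero_mul, Finset.sum_ite_eq,
    Finset.mem_univ, if_true, Finset.mul_sum]
  rfl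

/-- Tracing over `B` and then over `A` is the full trace, which removes all dependence on `A`. -/
theorem trace_reduced [Fintype V] [Fintype Eb] [DecidableEq Eb] [Fintype Ed] [DecidableEq Ed]
    (G : OpenGraph V Eb Ed) (D : ℕ) (A : Finset Ed)
    (g : (x : V) → G.VertexTensor D x) :
    (G.reduced D A g).trace = ∑ b : Ed → Fin D, G.state D g b * star (G.state D g b) := by
  simp only [Matrix.trace, Matrix.diag, reduced, Matrix.of_apply]
  rw [← Fintype.sum_prod_type']
  exact Fintype.sum_equiv (Equiv.piEquivPiSubtypeProd (· ∈ A) fun _ => Fin D).symm _ _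
    fun _ => rfl

/-- Every leg sits at exactly one vertex, so constraints grouped by vertex can be regrouped by edge.
A bulk edge receives one constraint from each end; a half-edge receives an invariance condition,
since its label is shared by the state and its conjugate. -/
theorem vertexLabel_matching_iff (G : OpenGraph V Eb Ed) {D n : ℕ} (α : V → Equiv.Perm (Fin n))
    (p : Fin n → (Ed → Fin D) × (Eb → Fin D) × (Eb → Fin D)) :
    (∀ x k, G.vertexLabel (p k).2.1 (p k).1 x =
      G.vertexLabel (p (α x k)).2.2 (p (α x k)).1 x) ↔
    (∀ e k, (p k).1 e = (p (α (G.foot e) k)).1 e) ∧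
      ∀ e, (∀ k, (p k).2.1 e = (p (α (G.src e) k)).2.2 e) ∧
        ∀ k, (p k).2.1 e = (p (α (G.tgt e) k)).2.2 e := by
  constructor
  · intro h
    refine ⟨fun e k => ?_, fun e => ⟨fun k => ?_, fun k => ?_⟩⟩
    · exact congrFun (h (G.foot e) k) ⟨Sum.inr (Sum.inr e), rfl⟩
    · exact congrFun (h (G.src e) k) ⟨Sum.inl e, rfl⟩
    · exact congrFun (h (G.tgt e) k) ⟨Sum.inr (Sum.inl e), rfl⟩
  · rintro ⟨hd, hb⟩ x k
    funext ⟨l, hl⟩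
    subst hl
    rcases l with e | e | e
    · exact (hb e).1 k
    · exact (hb e).2 k
    · exact hd e k

theorem trace_reduced_eq_sum [Fintype V] [Fintype Eb] [DecidableEq Eb] [Fintype Ed]
    [DecidableEq Ed] (G : OpenGraph V Eb Ed) (D : ℕ) (A : Finset Ed)
    (g : (x : V) → G.VertexTensor D x) :
    (G.reduced D A g).trace = ((D : ℂ) ^ Fintype.card Eb)⁻¹ *
      ∑ q : (Ed → Fin D) × (Eb → Fin D) × (Eb → Fin D),
        ∏ x, g x (G.vertexLabel q.2.1 q.1 x) * star (g x (G.vertexLabel q.2.2 q.1 x)) := by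
  have hsq : (((Real.sqrt D)⁻¹ : ℝ) : ℂ) * star (((Real.sqrt D)⁻¹ : ℝ) : ℂ) = (D : ℂ)⁻¹ := by
    rw [Complex.star_def, Complex.conj_ofReal, ← Complex.ofReal_mul, ← mul_inv,
      Real.mul_self_sqrt D.cast_nonneg]
    simp
  rw [trace_reduced, Fintype.sum_prod_type, Finset.mul_sum]
  refine Finset.sum_congr rfl fun b _ => ?_
  rw [state_eq, star_mul', mul_mul_mul_comm, star_pow, ← mul_pow, hsq, inv_pow, star_sum,
    Finset.sum_mul_sum, Fintype.sum_prod_type]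
  simp only [star_prod, Finset.prod_mul_distrib]

theorem normalized_trace_pow [Fintype V] [Fintype Eb] [DecidableEq Eb] [Fintype Ed]
    [DecidableEq Ed] (G : OpenGraph V Eb Ed) (D : ℕ) (A : Finset Ed) (n : ℕ)
    (g : (x : V) → G.VertexTensor D x) :
    (((D : ℂ) ^ Fintype.card Ed)⁻¹ • G.reduced D A g).trace ^ n =
      (((D : ℂ) ^ Fintype.card Ed)⁻¹ * ((D : ℂ) ^ Fintype.card Eb)⁻¹) ^ n *
      ∑ p : Fin n → (Ed → Fin D) × (Eb → Fin D) × (Eb → Fin D),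
        ∏ x, ∏ k, g x (G.vertexLabel (p k).2.1 (p k).1 x) *
          star (g x (G.vertexLabel (p k).2.2 (p k).1 x)) := by
  rw [Matrix.trace_smul, smul_eq_mul, trace_reduced_eq_sum, ← mul_assoc, mul_pow,
    Fintype.sum_pow]
  congr 1
  exact Finset.sum_congr rfl fun p _ => Finset.prod_comm

/-! ### Gaussian expectation as a partition function. -/

variable [Fintype V] [DecidableEq V] [Fintype Eb] [DecidableEq Eb] [Fintype Ed] [DecidableEq Ed]

theorem integrable_vertex_monomial (G : OpenGraph V Eb Ed) (D n : ℕ)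
    (i j : (x : V) → Fin n → G.LegsAt x → Fin D) :
    Integrable (fun g : (x : V) → G.VertexTensor D x =>
      ∏ x, ∏ k, g x (i x k) * star (g x (j x k))) (G.tensorLaw D) :=
  Integrable.fintype_prod_dep
    (f := fun x (z : G.VertexTensor D x) => ∏ k, z (i x k) * star (z (j x k)))
    fun x => integrable_gaussian_monomial (i x) (j x)

theorem integral_vertex_monomial (G : OpenGraph V Eb Ed) (D n : ℕ)
    (i j : (x : V) → Fin n → G.LegsAt x → Fin D) :
    ∫ g, ∏ x, ∏ k, g x (i x k) * star (g x (j x k)) ∂(G.tensorLaw D) =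
      ∑ α : V → Equiv.Perm (Fin n), if ∀ x k, i x k = j x (α x k) then (1 : ℂ) else 0 := by
  rw [tensorLaw, integral_fintype_prod_eq_prod
    fun x (z : G.VertexTensor D x) => ∏ k, z (i x k) * star (z (j x k))]
  simp only [integral_gaussian_monomial]
  rw [Finset.prod_univ_sum, Fintype.piFinset_univ]
  refine Finset.sum_congr rfl fun α _ => ?_
  split_ifs with h
  · exact Finset.prod_eq_one fun x _ => if_pos (h x)
  · obtain ⟨x, hx⟩ := not_forall.1 h
    exact Finset.prod_eq_zero (Finset.mem_univ x) (if_neg hx)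

theorem card_matched_labels (G : OpenGraph V Eb Ed) {D n : ℕ} (hD : 0 < D)
    (α : V → Equiv.Perm (Fin n)) :
    (∑ p : Fin n → (Ed → Fin D) × (Eb → Fin D) × (Eb → Fin D),
      if ∀ x k, G.vertexLabel (p k).2.1 (p k).1 x =
        G.vertexLabel (p (α x k)).2.2 (p (α x k)).1 x then (1 : ℂ) else 0) =
    ((D : ℂ) ^ Fintype.card Ed * (D : ℂ) ^ Fintype.card Eb) ^ n *
      (D : ℂ) ^ (-G.hamiltonian n α) := by
  have hD' : (D : ℂ) ≠ 0 := by exact_mod_cast hD.ne'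
  -- Transposing replicas and edges splits a matched labelling into independent choices, one per
  -- edge.
  let e : {p : Fin n → (Ed → Fin D) × (Eb → Fin D) × (Eb → Fin D) //
      (∀ e k, (p k).1 e = (p (α (G.foot e) k)).1 e) ∧
      ∀ e, (∀ k, (p k).2.1 e = (p (α (G.src e) k)).2.2 e) ∧
        ∀ k, (p k).2.1 e = (p (α (G.tgt e) k)).2.2 e} ≃
      ((e : Ed) → {f : Fin n → Fin D // ∀ k, f k = f (α (G.foot e) k)}) ×
      ((e : Eb) → {q : (Fin n → Fin D) × (Fin n → Fin D) //
        (∀ k, q.1 k = q.2 (α (G.src e) k)) ∧ ∀ k, q.1 k = q.2 (α (G.tgt e) k)}) :=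
    { toFun := fun p => (fun e => ⟨fun k => (p.1 k).1 e, p.2.1 e⟩,
        fun e => ⟨(fun k => (p.1 k).2.1 e, fun k => (p.1 k).2.2 e), p.2.2 e⟩)
      invFun := fun q => ⟨fun k => (fun e => (q.1 e).1 k, fun e => (q.2 e).1.1 k,
        fun e => (q.2 e).1.2 k), fun e => (q.1 e).2, fun e => (q.2 e).2⟩
      left_inv := fun _ => rfl
      right_inv := fun _ => rfl }
  simp only [vertexLabel_matching_iff]
  rw [Finset.sum_boole, ← Fintype.card_subtype, Fintype.card_congr e, Fintype.card_prod,
    Fintype.card_pi, Fintype.card_pi]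
  simp only [card_matched_pairs, Nat.cast_mul, Nat.cast_prod,
    card_invariant_functions_eq_zpow hD, Finset.prod_mul_distrib, Finset.prod_const,
    Finset.card_univ]
  rw [prod_zpow_neg hD', prod_zpow_neg hD', hamiltonian, neg_add, zpow_add₀ hD']
  simp only [inv_one, one_mul]
  ring

theorem integrable_normalized_trace_pow (G : OpenGraph V Eb Ed) (D : ℕ) (A : Finset Ed) (n : ℕ) :
    Integrable (fun g => (((D : ℂ) ^ Fintype.card Ed)⁻¹ • G.reduced D A g).trace ^ n)
      (G.tensorLaw D) := by
  simp only [normalized_trace_pow]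
  exact (integrable_finsetSum _ fun p _ => G.integrable_vertex_monomial D n _ _).const_mul _

theorem integral_normalized_trace_pow (G : OpenGraph V Eb Ed) {D : ℕ} (hD : 0 < D)
    (A : Finset Ed) (n : ℕ) :
    ∫ g, (((D : ℂ) ^ Fintype.card Ed)⁻¹ • G.reduced D A g).trace ^ n ∂(G.tensorLaw D) =
      ∑ α : V → Equiv.Perm (Fin n), (D : ℂ) ^ (-G.hamiltonian n α) := by
  have hD' : (D : ℂ) ≠ 0 := by exact_mod_cast hD.ne'
  simp only [normalized_trace_pow]
  rw [integral_const_mul, integral_finsetSum _ fun p _ => G.integrable_vertex_monomial D n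
    (fun x k => G.vertexLabel (p k).2.1 (p k).1 x) fun x k => G.vertexLabel (p k).2.2 (p k).1 x]
  simp only [fun p : Fin n → (Ed → Fin D) × (Eb → Fin D) × (Eb → Fin D) =>
    G.integral_vertex_monomial D n (fun x k => G.vertexLabel (p k).2.1 (p k).1 x)
      fun x k => G.vertexLabel (p k).2.2 (p k).1 x]
  -- With `α` outermost, the inner sum over labels is the edgewise count.
  rw [Finset.sum_comm]
  simp only [G.card_matched_labels hD]
  rw [← Finset.mul_sum, ← mul_assoc, ← mul_pow, ← mul_inv, inv_mul_cancel₀ (by positivity),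
    one_pow, one_mul]

end OpenGraph

theorem corollary5p13 {V Eb Ed : Type*} [Fintype V] [DecidableEq V] [Fintype Eb] [DecidableEq Eb]
    [Fintype Ed] [DecidableEq Ed] (G : OpenGraph V Eb Ed) (hG : G.BulkConnected)
    (hEd : Nonempty Ed) (n : ℕ) :
    (∀ A : Finset Ed,
      (∀ D : ℕ, 0 < D → Integrable
        (fun g => (((D : ℂ) ^ Fintype.card Ed)⁻¹ • G.reduced D A g).trace ^ n)
        (G.tensorLaw D)) ∧
      Tendsto
        (fun D : ℕ => ∫ g, (((D : ℂ) ^ Fintype.card Ed)⁻¹ • G.reduced D A g).trace ^ n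
          ∂(G.tensorLaw D))
        atTop (𝓝 1)) ∧
    IsLeast (Set.range (G.hamiltonian n)) 0 ∧
    ∀ α : V → Equiv.Perm (Fin n), G.hamiltonian n α = 0 ↔ ∀ x, α x = 1 := by
  refine ⟨fun A => ⟨fun D _ => G.integrable_normalized_trace_pow D A n, ?_⟩,
    G.isLeast_hamiltonian hG hEd n, G.hamiltonian_eq_zero_iff hG hEd n⟩
  refine (G.tendsto_sum_zpow_neg_hamiltonian hG hEd n).congr' ?_
  -- The exact formula divides by powers of `D`, so `D = 0` is discarded.
  filter_upwards [eventually_gt_atTop 0] with D hD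
  exact (G.integral_normalized_trace_pow hD A n).symm
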